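/- For an infinite word $w=w_0w_1w_2\cdots$ over a finite alphabet $A$, let $p_w(n)$ denote the number of distinct factors of $w$ of length $n$, that is, of words $v\in A^n$ such that $w=v'vv''$ for some finite word $v'$ and some infinite word $v''$ over $A$. There exists a non-increasing function $C:(0,+\infty)\to[1,+\infty)$ with $C(h)\le 4$ for every $h\ge\log 2$, such that for every $h\in(0,+\infty)$ there is an infinite word $w$ over an alphabet with $\lceil e^h\rceil$ letters satisfying $$e^{hn}\le p_w(n)\le C(h)\,e^{hn}\qquad\text{for every integer } n\ge 0.$$ -/

import Mathlib

namespace InfiniteWord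

/-- The language `L(w)` of an infinite word `w = w₀w₁w₂⋯`: the set of its finite factors, i.e. of
the finite words `v` such that `w = v' v v''` for a finite word `v'` and an infinite word `v''`. -/
def language {A : Type*} (w : Stream' A) : Set (List A) :=
  {v | ∃ (v' : List A) (v'' : Stream' A), w = v' ++ₛ (v ++ₛ v'')}

/-- `L_n(w)`: the factors of `w` of length `n`. -/
def factors {A : Type*} (w : Stream' A) (n : ℕ) : Set (List A) :=
  {v ∈ language w | v.length = n}

/-- Over a finite alphabet `L_n(w)` is finite, so its `Set.ncard` is its number of elements. -/
theorem factors_finite {A : Type*} [Finite A] (w : Stream' A) (n : ℕ) : (factors w n).Finite :=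
  (List.finite_length_eq A n).subset fun _ hv => hv.2

/-- The complexity function `p_w(n) = |L_n(w)|`. -/
noncomputable def complexity {A : Type*} (w : Stream' A) (n : ℕ) : ℕ :=
  (factors w n).ncard

end InfiniteWord

/-!
The word is a generic point of the `β`-shift with `β = exp h`. A finite word is read as a run of a
deterministic automaton with states in `(-∞, 1]`: reading the letter `c` in state `r` leads to the
state `min 1 (β * r - c)`, and the word is accepted if all the states met are positive.
-/

/-! Let `β = exp h`, `k = ⌈β⌉`, and let `N n r` be the number of admissible words of length `n` from
state `r`. Splitting off the first letter, `N (n+1) r` is the sum of `N n` over the successor states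
`min 1 (β * r - c)`. Since `β ≤ k`, the positive parts of these states add up to exactly `β * r`, so
`r` behaves like an eigenfunction: `le_ncard_betaWords` gives `N n 1 ≥ β ^ n`. At most `β * r + 1`
successors are positive, which gives `ncard_betaWords_one_le`, with constant `β / (β - 1)`.

It remains to find a word whose factors are exactly the words admissible from `1`
(`exists_language_eq_betaAdmissible`). These are closed under factors, and zeros drive any positive
state back to `1`, so all of them can be joined into one infinite word. -/

namespace InfiniteWord

section BetaShift

variable {k : ℕ} (β : ℝ)

/-- The state reached from `r` by reading a word of digits. -/
noncomputable def betaState : ℝ → List (Fin k) → ℝ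
  | r, [] => r
  | r, c :: v => betaState (min 1 (β * r - (c : ℕ))) v

/-- The words whose digits keep all the states met positive, starting from `r`. -/
def BetaAdmissible : ℝ → List (Fin k) → Prop
  | r, [] => 0 < r
  | r, c :: v => 0 < r ∧ BetaAdmissible (min 1 (β * r - (c : ℕ))) v

variable {β}

theorem BetaAdmissible.pos {r : ℝ} {v : List (Fin k)} (hv : BetaAdmissible β r v) : 0 < r := by
  cases v with
  | nil => exact hv
  | cons c v => exact hv.1

theorem BetaAdmissible.mono (hβ : 0 ≤ β) {r s : ℝ} (hrs : r ≤ s) {v : List (Fin k)}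
    (hv : BetaAdmissible β r v) : BetaAdmissible β s v := by
  induction v generalizing r s with
  | nil => exact lt_of_lt_of_le hv hrs
  | cons c v ih =>
    refine ⟨hv.1.trans_le hrs, ih ?_ hv.2⟩
    gcongr

theorem betaState_le_one {r : ℝ} (hr : r ≤ 1) (v : List (Fin k)) : betaState β r v ≤ 1 := by
  induction v generalizing r with
  | nil => exact hr
  | cons c v ih => exact ih (min_le_left _ _)

theorem betaState_append (r : ℝ) (u v : List (Fin k)) :
    betaState β r (u ++ v) = betaState β (betaState β r u) v := by
  induction u generalizing r with
  | nil => rfl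
  | cons c u ih => exact ih _

theorem betaAdmissible_append {r : ℝ} {u v : List (Fin k)} :
    BetaAdmissible β r (u ++ v) ↔
      BetaAdmissible β r u ∧ BetaAdmissible β (betaState β r u) v := by
  induction u generalizing r with
  | nil => exact ⟨fun h => ⟨h.pos, h⟩, fun h => h.2⟩
  | cons c u ih =>
    simp only [List.cons_append, BetaAdmissible, betaState, ih, and_assoc]

theorem BetaAdmissible.betaState_pos {r : ℝ} {v : List (Fin k)} (hv : BetaAdmissible β r v) :
    0 < betaState β r v := by
  rw [← List.append_nil v, betaAdmissible_append] at hv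
  exact hv.2

/-- The state after `u` is at most `1`, and raising the starting state preserves admissibility. -/
theorem BetaAdmissible.of_append_right (hβ : 0 ≤ β) {u v : List (Fin k)}
    (h : BetaAdmissible β 1 (u ++ v)) : BetaAdmissible β 1 v :=
  (betaAdmissible_append.1 h).2.mono hβ (betaState_le_one le_rfl u)

theorem betaAdmissible_replicate_zero [NeZero k] (hβ : 1 < β) (m : ℕ) {r : ℝ} (hr : 0 < r)
    (hr1 : r ≤ 1) :
    BetaAdmissible β r (List.replicate m (0 : Fin k)) ∧
      betaState β r (List.replicate m (0 : Fin k)) = min 1 (β ^ m * r) := by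
  induction m generalizing r with
  | zero => simpa [BetaAdmissible, betaState] using ⟨hr, hr1⟩
  | succ m ih =>
    have hpos : 0 < min 1 (β * r) := lt_min one_pos (by positivity)
    obtain ⟨h₁, h₂⟩ := ih hpos (min_le_left _ _)
    simp only [List.replicate_succ, BetaAdmissible, betaState, Fin.val_zero, Nat.cast_zero,
      sub_zero]
    refine ⟨⟨hr, h₁⟩, h₂.trans ?_⟩
    have hm : 1 ≤ β ^ m := one_le_pow₀ hβ.le
    rw [mul_min_of_nonneg _ _ (by positivity), mul_one, ← min_assoc, min_eq_left hm, pow_succ,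
      mul_assoc]

/-- Admissible words can be joined by sufficiently many zeros. -/
theorem exists_betaAdmissible_append_replicate [NeZero k] (hβ : 1 < β) {u : List (Fin k)}
    (hu : BetaAdmissible β 1 u) :
    ∃ m : ℕ, ∀ v : List (Fin k), BetaAdmissible β 1 v →
      BetaAdmissible β 1 (u ++ List.replicate (m + 1) 0 ++ v) := by
  have hpos := hu.betaState_pos
  -- Each zero multiplies the state by `β` until the cap `1` is reached. The extra zero in `m + 1`
  -- makes the joined word strictly longer than `u`, even for empty `v`.
  obtain ⟨m, hm⟩ := pow_unbounded_of_one_lt (betaState β 1 u)⁻¹ hβ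
  refine ⟨m, fun v hv => ?_⟩
  obtain ⟨h₁, h₂⟩ :=
    betaAdmissible_replicate_zero (k := k) hβ (m + 1) hpos (betaState_le_one le_rfl u)
  have hone : 1 ≤ β ^ (m + 1) * betaState β 1 u := by
    have : (betaState β 1 u)⁻¹ ≤ β ^ (m + 1) :=
      hm.le.trans (pow_le_pow_right₀ hβ.le m.le_succ)
    rwa [inv_le_iff_one_le_mul₀ hpos] at this
  rw [betaAdmissible_append, betaAdmissible_append, betaState_append, h₂, min_eq_left hone]
  exact ⟨⟨hu, h₁⟩, hv⟩

end BetaShift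

section Count

variable {k : ℕ} {β : ℝ}

/-- The admissible words of length `n`, starting from the state `r`. -/
def betaWords (k : ℕ) (β : ℝ) (n : ℕ) (r : ℝ) : Set (List (Fin k)) :=
  {v | BetaAdmissible β r v ∧ v.length = n}

theorem betaWords_finite (n : ℕ) (r : ℝ) : (betaWords k β n r).Finite :=
  (List.finite_length_eq (Fin k) n).subset fun _ hv => hv.2

theorem betaWords_eq_empty (n : ℕ) {r : ℝ} (hr : r ≤ 0) : betaWords k β n r = ∅ :=
  Set.eq_empty_of_forall_notMem fun _ hv => hr.not_gt hv.1.pos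

theorem ncard_betaWords_zero {r : ℝ} (hr : 0 < r) : (betaWords k β 0 r).ncard = 1 := by
  rw [Set.ncard_eq_one]
  refine ⟨[], Set.eq_singleton_iff_unique_mem.2 ⟨⟨hr, rfl⟩, fun v hv => ?_⟩⟩
  exact List.length_eq_zero_iff.1 hv.2

theorem ncard_betaWords_succ (n : ℕ) {r : ℝ} (hr : 0 < r) :
    (betaWords k β (n + 1) r).ncard =
      ∑ c ∈ Finset.range k, (betaWords k β n (min 1 (β * r - c))).ncard := by
  have hunion : betaWords k β (n + 1) r =
      ⋃ c : Fin k, List.cons c '' betaWords k β n (min 1 (β * r - (c : ℕ))) := by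
    ext v
    cases v with
    | nil => simp [betaWords]
    | cons c v => simp [betaWords, BetaAdmissible, hr]
  rw [hunion, Set.ncard_iUnion_of_finite (fun c => (betaWords_finite n _).image _),
    finsum_eq_sum_of_fintype,
    ← Fin.sum_univ_eq_sum_range fun c => (betaWords k β n (min 1 (β * r - (c : ℕ)))).ncard]
  · exact Finset.sum_congr rfl fun c _ => Set.ncard_image_of_injective _ (List.cons_injective)
  · intro c d hcd
    rw [Function.onFun, Set.disjoint_left]
    rintro _ ⟨u, -, rfl⟩ ⟨v, -, h⟩
    exact hcd (List.cons.inj h).1.symm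

/-- The summand is the length of `[0, y] ∩ [c, c + 1]`, and these intervals tile `[0, y] ∩ [0, k]`.
-/
theorem sum_range_max_zero_min_one_sub {y : ℝ} (hy : 0 ≤ y) (k : ℕ) :
    ∑ c ∈ Finset.range k, max 0 (min 1 (y - c)) = min y k := by
  induction k with
  | zero => simp [hy]
  | succ k ih =>
    rw [Finset.sum_range_succ, ih]
    push_cast
    grind

theorem sum_range_ite_lt_le {y : ℝ} (hy : 0 ≤ y) (k : ℕ) :
    ∑ c ∈ Finset.range k, (if (c : ℝ) < y then (1 : ℝ) else 0) ≤ y + 1 := by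
  rw [Finset.sum_boole]
  have hsub : (Finset.range k).filter (fun c : ℕ => (c : ℝ) < y) ⊆ Finset.range ⌈y⌉₊ := fun c hc =>
    Finset.mem_range.2 (Nat.lt_ceil.2 (Finset.mem_filter.1 hc).2)
  have hcard := Finset.card_le_card hsub
  rw [Finset.card_range] at hcard
  exact (Nat.cast_le.2 hcard).trans (Nat.ceil_lt_add_one hy).le

theorem le_ncard_betaWords (hβ : 0 < β) (hk : β ≤ k) (n : ℕ) {r : ℝ} (hr : r ≤ 1) :
    max 0 r * β ^ n ≤ ((betaWords k β n r).ncard : ℝ) := by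
  rcases le_or_gt r 0 with h0 | h0
  · simp [max_eq_left h0]
  induction n generalizing r with
  | zero => simpa [ncard_betaWords_zero h0, max_eq_right h0.le] using hr
  | succ n ih =>
    have hy : β * r ≤ k := (mul_le_of_le_one_right hβ.le hr).trans hk
    rw [ncard_betaWords_succ n h0, Nat.cast_sum]
    calc max 0 r * β ^ (n + 1) = min (β * r) k * β ^ n := by
          rw [max_eq_right h0.le, min_eq_left hy]; ring
      _ = ∑ c ∈ Finset.range k, max 0 (min 1 (β * r - c)) * β ^ n := by
          rw [← sum_range_max_zero_min_one_sub (by positivity), Finset.sum_mul]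
      _ ≤ _ := by
          refine Finset.sum_le_sum fun c _ => ?_
          rcases le_or_gt (min 1 (β * r - c)) 0 with h | h
          · simp [max_eq_left h]
          · exact ih (min_le_left _ _) h

/-- With an affine bound `x * r + 1` at level `n`, the linear parts sum to at most `x * β * r` and
the ones to at most `β * r + 1`, so the slope evolves by `x ↦ β * x + β`. -/
theorem ncard_betaWords_le (hβ : 0 < β) (n : ℕ) {r : ℝ} (h0 : 0 < r) :
    ((betaWords k β n r).ncard : ℝ) ≤ (∑ i ∈ Finset.range n, β ^ (i + 1)) * r + 1 := by
  induction n generalizing r with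
  | zero => simp [ncard_betaWords_zero h0]
  | succ n ih =>
    set x : ℝ := ∑ i ∈ Finset.range n, β ^ (i + 1) with hx
    have hx0 : 0 ≤ x := Finset.sum_nonneg fun i _ => by positivity
    have hsucc : ∑ i ∈ Finset.range (n + 1), β ^ (i + 1) = β * x + β := by
      rw [Finset.sum_range_succ', hx, Finset.mul_sum]
      simp [pow_succ']
    have hy : 0 ≤ β * r := by positivity
    rw [ncard_betaWords_succ n h0, Nat.cast_sum, hsucc]
    calc ∑ c ∈ Finset.range k, ((betaWords k β n (min 1 (β * r - c))).ncard : ℝ)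
        ≤ ∑ c ∈ Finset.range k,
            (x * max 0 (min 1 (β * r - c)) + if (c : ℝ) < β * r then (1 : ℝ) else 0) := by
          refine Finset.sum_le_sum fun c _ => ?_
          rcases lt_or_ge (c : ℝ) (β * r) with h | h
          · have hpos : 0 < min 1 (β * r - c) := lt_min one_pos (sub_pos.2 h)
            rw [if_pos h, max_eq_right hpos.le]
            exact ih hpos
          · have hneg : min 1 (β * r - c) ≤ 0 := min_le_of_right_le (sub_nonpos.2 h)
            rw [betaWords_eq_empty n hneg, if_neg h.not_gt, max_eq_left hneg]
            simp
      _ ≤ x * (β * r) + (β * r + 1) := by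
          rw [Finset.sum_add_distrib, ← Finset.mul_sum, sum_range_max_zero_min_one_sub hy]
          gcongr
          · exact min_le_left _ _
          · exact sum_range_ite_lt_le hy k
      _ = (β * x + β) * r + 1 := by ring

theorem ncard_betaWords_one_le (hβ : 1 < β) (n : ℕ) :
    ((betaWords k β n 1).ncard : ℝ) ≤ (1 + (β - 1)⁻¹) * β ^ n := by
  have h := ncard_betaWords_le (k := k) (zero_lt_one.trans hβ) n one_pos
  have hsum : (∑ i ∈ Finset.range n, β ^ (i + 1)) * 1 + 1 = (β ^ (n + 1) - 1) / (β - 1) := by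
    rw [← geom_sum_eq hβ.ne', Finset.sum_range_succ', mul_one, pow_zero]
  have hβ' : 0 < β - 1 := sub_pos.2 hβ
  rw [hsum] at h
  refine h.trans ?_
  rw [div_le_iff₀ hβ']
  have : (1 + (β - 1)⁻¹) * β ^ n * (β - 1) = β ^ (n + 1) := by
    field_simp
    ring
  linarith

end Count

section Word

/-- An increasing chain of finite words of unbounded length has a limit. -/
theorem exists_stream_of_prefix_chain {A : Type*} [Inhabited A] (u : ℕ → List A)
    (hu : ∀ n, u n <+: u (n + 1)) (hlen : ∀ n, n ≤ (u n).length) :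
    ∃ w : Stream' A, ∀ n, ∃ s : Stream' A, w = u n ++ₛ s := by
  have hmono : ∀ m n, m ≤ n → u m <+: u n := fun m n hmn =>
    Nat.le_induction (List.prefix_refl _) (fun n _ h => h.trans (hu n)) n hmn
  -- The default is never used: `u (i + 1)` has length greater than `i`.
  let w : Stream' A := fun i => (u (i + 1)).getD i default
  refine ⟨w, fun n => ⟨w.drop (u n).length, ?_⟩⟩
  have htake : w.take (u n).length = u n := by
    refine List.ext_getElem (Stream'.length_take _ _) fun i h₁ h₂ => ?_
    have hi : i < (u (i + 1)).length := hlen (i + 1)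
    rw [Stream'.take_get]
    change (u (i + 1)).getD i default = _
    rw [List.getD_eq_getElem _ _ hi]
    rcases le_total (i + 1) n with h | h
    · exact (hmono _ _ h).getElem hi
    · exact ((hmono _ _ h).getElem h₂).symm
  conv_lhs => rw [← Stream'.append_take_drop (u n).length w, htake]

/-- There is an infinite word whose factors are exactly the admissible words. -/
theorem exists_language_eq_betaAdmissible {k : ℕ} [NeZero k] {β : ℝ} (hβ : 1 < β) :
    ∃ w : Stream' (Fin k), language w = {v | BetaAdmissible β 1 v} := by
  have hβ0 : 0 ≤ β := zero_le_one.trans hβ.le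
  have : Nonempty {v : List (Fin k) // BetaAdmissible β 1 v} := ⟨⟨[], one_pos⟩⟩
  obtain ⟨e, he⟩ := exists_surjective_nat {v : List (Fin k) // BetaAdmissible β 1 v}
  choose m hm using fun u : {v : List (Fin k) // BetaAdmissible β 1 v} =>
    exists_betaAdmissible_append_replicate hβ u.2
  -- Append every admissible word in turn, after a block of zeros that resets the state to `1`.
  let u : ℕ → {v : List (Fin k) // BetaAdmissible β 1 v} := fun n =>
    Nat.rec ⟨[], one_pos⟩ (fun n u => ⟨_, hm u (e n) (e n).2⟩) n
  have husucc : ∀ n, (u (n + 1)).1 = (u n).1 ++ List.replicate (m (u n) + 1) 0 ++ (e n).1 :=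
    fun _ => rfl
  have hlen : ∀ n, n ≤ (u n).1.length := by
    intro n
    induction n with
    | zero => exact Nat.zero_le _
    | succ n ih =>
      simp only [husucc, List.length_append, List.length_replicate]
      omega
  obtain ⟨w, hw⟩ := exists_stream_of_prefix_chain (fun n => (u n).1)
    (fun n => by simp only [husucc, List.append_assoc]; exact List.prefix_append _ _) hlen
  refine ⟨w, Set.ext fun v => ⟨?_, fun hv => ?_⟩⟩
  · rintro ⟨v', v'', hv⟩
    obtain ⟨s, hs⟩ := hw (v' ++ v).length
    have hpre : v' ++ v <+: (u (v' ++ v).length).1 := by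
      rw [List.prefix_iff_eq_take]
      have h := congrArg (Stream'.take (v' ++ v).length) (hv.symm.trans hs)
      rwa [← Stream'.append_append_stream, Stream'.take_append_of_le_length _ _ _ le_rfl,
        List.take_length, Stream'.take_append_of_le_length _ _ _ (hlen _)] at h
    obtain ⟨t, ht⟩ := hpre
    have hadm := (u (v' ++ v).length).2
    rw [← ht] at hadm
    exact (betaAdmissible_append.1 hadm).1.of_append_right hβ0
  · obtain ⟨n, hn⟩ := he ⟨v, hv⟩
    obtain ⟨s, hs⟩ := hw (n + 1)
    refine ⟨(u n).1 ++ List.replicate (m (u n) + 1) 0, s, ?_⟩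
    rw [← Stream'.append_append_stream, hs]
    simp only [husucc, hn]

end Word

end InfiniteWord

theorem theorem8p1 :
    ∃ C : Set.Ioi (0 : ℝ) → Set.Ici (1 : ℝ),
      Antitone C ∧
      (∀ h : Set.Ioi (0 : ℝ), Real.log 2 ≤ (h : ℝ) → (C h : ℝ) ≤ 4) ∧
      ∀ h : Set.Ioi (0 : ℝ), ∃ w : Stream' (Fin ⌈Real.exp (h : ℝ)⌉₊), ∀ n : ℕ,
        Real.exp ((h : ℝ) * (n : ℝ)) ≤ (InfiniteWord.complexity w n : ℝ) ∧
        (InfiniteWord.complexity w n : ℝ) ≤ (C h : ℝ) * Real.exp ((h : ℝ) * (n : ℝ)) := by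
  have hexp : ∀ h : Set.Ioi (0 : ℝ), 0 < Real.exp h - 1 := fun h =>
    sub_pos.2 (Real.one_lt_exp_iff.2 h.2)
  -- This is `β / (β - 1)`, which is at most `2` once `β ≥ 2`.
  refine ⟨fun h => ⟨1 + (Real.exp h - 1)⁻¹,
    le_add_of_nonneg_right (inv_nonneg.2 (hexp h).le)⟩, ?_, ?_, ?_⟩
  · intro a b hab
    have hab' : (a : ℝ) ≤ b := hab
    have := hexp a
    change 1 + (Real.exp b - 1)⁻¹ ≤ 1 + (Real.exp a - 1)⁻¹
    gcongr
  · intro h hh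
    have h2 : 2 ≤ Real.exp h := (Real.log_le_iff_le_exp two_pos).1 hh
    have : (Real.exp h - 1)⁻¹ ≤ 1 := inv_le_one_of_one_le₀ (by linarith)
    change 1 + (Real.exp h - 1)⁻¹ ≤ 4
    linarith
  · intro h
    have hβ : 1 < Real.exp h := Real.one_lt_exp_iff.2 h.2
    have : NeZero ⌈Real.exp (h : ℝ)⌉₊ := ⟨(Nat.ceil_pos.2 (Real.exp_pos _)).ne'⟩
    obtain ⟨w, hw⟩ :=
      InfiniteWord.exists_language_eq_betaAdmissible (k := ⌈Real.exp (h : ℝ)⌉₊) hβ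
    refine ⟨w, fun n => ?_⟩
    have hc : InfiniteWord.complexity w n =
        (InfiniteWord.betaWords ⌈Real.exp (h : ℝ)⌉₊ (Real.exp h) n 1).ncard := by
      rw [InfiniteWord.complexity, InfiniteWord.factors, hw]
      rfl
    rw [hc, mul_comm (h : ℝ), Real.exp_nat_mul]
    refine ⟨?_, InfiniteWord.ncard_betaWords_one_le hβ n⟩
    simpa using InfiniteWord.le_ncard_betaWords (Real.exp_pos h) (Nat.le_ceil _) n le_rfl
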